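/- A \emph{$c$-arc-colored digraph} is a finite digraph $G$ without loops and parallel arcs (opposite arcs $uv$, $vu$ are allowed) together with an arbitrary map $\phi\colon A(G)\to\{1,\dots,c\}$. A \emph{trail} is a directed walk with at least one arc that repeats no arc. A trail is a \emph{PC FEV trail} (properly colored with fixed end-vertices) if any two consecutive arcs have different colors; it is \emph{properly colored} (PC) if, in addition, its first and last arcs have different colors whenever the trail is closed (ends at the vertex at which it starts). $G$ is \emph{PC trail-connected} if for all arcs $f_1,f_2$ of $G$ there is a PC trail starting with the arc $f_1$ and ending with the arc $f_2$. It can be decided in polynomial time whether a given $c$-arc-colored digraph $G$ is PC trail-connected. The same holds for the variant of the notion in which the trails from $f_1$ to $f_2$ are only required to be PC FEV trails. Here $c$ is part of the input, and the input consists of $|V(G)|$, $c$ and the list, in any order, of all arcs, each with its tail, its head and its color, all numbers being written in binary. Polynomial time means: by a Turing machine whose number of steps is at most a polynomial in the length of the input. -/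

import Mathlib

/-- A `c`-arc-colored digraph on the vertex set `V`: a set of arcs, i.e. of ordered pairs of
distinct vertices (so there are no loops and no parallel arcs, while opposite arcs `uv`, `vu` are
allowed), together with an arbitrary map from the arcs to the `c` colors. -/
structure ArcColoredDigraph (V : Type) (c : ℕ) where
  /-- the arcs; `(u, v)` is the arc with tail `u` and head `v` -/
  arcs : Set (V × V)
  /-- no loops -/
  loopless : ∀ v : V, (v, v) ∉ arcs
  /-- the coloring of the arcs -/
  color : arcs → Fin c

namespace ArcColoredDigraph

variable {V : Type} {c : ℕ}

/-- The type of arcs of `G`. -/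
abbrev Arc (G : ArcColoredDigraph V c) : Type := G.arcs

/-- The tail `u` of an arc `uv`. -/
def tail (G : ArcColoredDigraph V c) (f : G.Arc) : V := f.1.1

/-- The head `v` of an arc `uv`. -/
def head (G : ArcColoredDigraph V c) (f : G.Arc) : V := f.1.2

/-- A (directed) trail with at least one arc, given by its sequence of arcs: each arc starts where
the previous one ends, and no arc is repeated. -/
def IsTrail (G : ArcColoredDigraph V c) (T : List G.Arc) : Prop :=
  T ≠ [] ∧ T.IsChain (fun e f => G.head e = G.tail f) ∧ T.Nodup

/-- `T` starts with the arc `f`. -/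
def StartsWith (G : ArcColoredDigraph V c) (T : List G.Arc) (f : G.Arc) : Prop :=
  T.head? = some f

/-- `T` ends with the arc `f`. -/
def EndsWith (G : ArcColoredDigraph V c) (T : List G.Arc) (f : G.Arc) : Prop :=
  T.getLast? = some f

/-- A properly colored trail with fixed end-vertices: any two consecutive arcs differ in color.
Nothing is required of the first and the last arc, even if the trail is closed. -/
def IsPCFEVTrail (G : ArcColoredDigraph V c) (T : List G.Arc) : Prop :=
  G.IsTrail T ∧ T.IsChain (fun e f => G.color e ≠ G.color f)

/-- A properly colored trail: any two consecutive arcs differ in color, and so do the first and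
the last arc if the trail is closed, i.e. if it ends at the vertex at which it starts. -/
def IsPCTrail (G : ArcColoredDigraph V c) (T : List G.Arc) : Prop :=
  G.IsTrail T ∧ T.IsChain (fun e f => G.color e ≠ G.color f) ∧
    ∀ e f : G.Arc, G.StartsWith T e → G.EndsWith T f → G.head f = G.tail e →
      G.color e ≠ G.color f

/-- `G` is PC trail-connected: for all arcs `f₁`, `f₂` there is a properly colored trail starting
with `f₁` and ending with `f₂`. -/
def PCTrailConnected (G : ArcColoredDigraph V c) : Prop :=
  ∀ f₁ f₂ : G.Arc, ∃ T : List G.Arc, G.IsPCTrail T ∧ G.StartsWith T f₁ ∧ G.EndsWith T f₂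

/-- The variant of PC trail-connectivity in which a trail from `f₁` to `f₂` that happens to be
closed need not be properly colored at its end-vertex. -/
def PCFEVTrailConnected (G : ArcColoredDigraph V c) : Prop :=
  ∀ f₁ f₂ : G.Arc, ∃ T : List G.Arc, G.IsPCFEVTrail T ∧ G.StartsWith T f₁ ∧ G.EndsWith T f₂

end ArcColoredDigraph

/-- An input of the algorithm: a number `c` of colors, a `c`-arc-colored digraph `G` with vertices
`0, …, n - 1`, and a list of all arcs of `G`, in any order and each exactly once. -/
structure DigraphInput where
  /-- the number of vertices -/
  n : ℕ
  /-- the number of colors -/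
  c : ℕ
  /-- the digraph -/
  G : ArcColoredDigraph (Fin n) c
  /-- the arcs, in the order in which the input lists them -/
  arcList : List G.Arc
  /-- no arc is listed twice -/
  nodup : arcList.Nodup
  /-- every arc is listed -/
  complete : ∀ f : G.Arc, f ∈ arcList

/-- A natural number as a binary word, followed by the separator `none`. -/
def encodeNumber (k : ℕ) : List (Option Bool) :=
  (Nat.bits k).map some ++ [none]

/-- The input as a word over the alphabet `{0, 1, separator}`: the number of vertices, the number of
colors, and then, for each arc, its tail, its head and its color; all numbers are in binary. -/
def DigraphInput.encode (I : DigraphInput) : List (Option Bool) :=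
  encodeNumber I.n ++ encodeNumber I.c ++
    I.arcList.flatMap (fun f =>
      encodeNumber (I.G.tail f : ℕ) ++ encodeNumber (I.G.head f : ℕ) ++
        encodeNumber (I.G.color f : ℕ))

/-- The property `P` of the elements of `α`, given as words by `enc`, is decided by a Turing machine
whose number of steps is bounded by a polynomial in the length of the word. -/
def DecidableInPolyTime {α Γ : Type} (enc : α → List Γ) (P : α → Prop) : Prop :=
  ∃ d : α → Bool, (∀ a, d a = true ↔ P a) ∧
    Nonempty (Turing.TM2ComputableInPolyTime enc Computability.encodeBool d)

/-! Trails become plain reachability in the digraph whose vertices are the arcs of `G`, with a step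
from `e` to `f` when `f` leaves the head of `e` and has another color. A walk in it from `f₁` to
`f₂` is a PC FEV trail except that arcs may recur, and cutting out the detours between two
occurrences of an arc preserves both end arcs (`exists_isPCFEVTrail_iff`). The extra condition on
closed PC trails involves only the first and last arc, so it is a condition on the pair `f₁`, `f₂`
and not on the trail (`pcTrailConnected_iff`). Hence both properties are decided by a breadth-first
search from every arc, together with a test of all pairs of arcs in the PC case.

The rest is an implementation with a time bound. Programs are assembled from fragments whose
behavior holds inside any host machine, so correctness and running time compose (`Runs.seq` and the
rules for branches and loops). On top of symbol loops come operations on binary numbers, then on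
arcs stored as triples of numbers. The search is correct because the unseen arcs left at the end are
closed under predecessors (`exec_search`, `exec_visit`). If `N` bounds the number of arcs and the
length of every number, the program takes at most `500 * (N + 1) ^ 4` steps (`exec_program`), and
the input length is such an `N`. -/

namespace StackMachine

/-! ### Stacks, finite memory and single steps -/

open Turing

/-- The alphabet of the internal stacks. -/
abbrev Sym : Type := Option Bool

variable {S V : Type}

/-- The alphabets of the stacks: `none` is the output stack, the others are internal. -/
def Alph (S : Type) : Option S → Type
  | none => Bool
  | some _ => Sym

/-- The finite memory: two symbols read last, the result of a comparison, and user flags. -/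
structure Store (V : Type) where
  /-- the first symbol register -/
  x : Option Sym
  /-- the second symbol register -/
  y : Option Sym
  /-- the result of a running comparison -/
  eq : Bool
  /-- the flags of the program -/
  v : V

/-- A store as a tuple. -/
def Store.equivProd : Store V ≃ Option Sym × Option Sym × Bool × V where
  toFun s := (s.x, s.y, s.eq, s.v)
  invFun p := ⟨p.1, p.2.1, p.2.2.1, p.2.2.2⟩

instance [Fintype V] : Fintype (Store V) := Fintype.ofEquiv _ Store.equivProd.symm

/-- The store between two instructions, with neutral contents of the registers. -/
def rest (v : V) : Store V := ⟨none, none, true, v⟩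

/-- The statements of a machine with labels `L`. -/
abbrev Code (S V L : Type) : Type := TM2.Stmt (Alph S) L (Store V)

/-- The contents of all stacks, when the output stack is empty. -/
def extend (st : S → List Sym) : ∀ k, List (Alph S k)
  | none => []
  | some k => st k

/-- The stack alphabets of a machine form a dependent family. Passing updates through `extend` lets
all later arguments use the non-dependent function `st`. -/
theorem update_extend [DecidableEq S] (st : S → List Sym) (k : S) (l : List Sym) :
    Function.update (extend st) (some k) l = extend (Function.update st k l) := by
  funext j
  by_cases h : j = some k
  · subst h
    exact (Function.update_self ..).trans (Function.update_self (f := st) ..).symm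
  · refine (Function.update_of_ne h (a' := some k) (v := l) (f := extend st)).trans ?_
    cases j with
    | none => rfl
    | some j => exact (Function.update_of_ne (f := st) (fun e => h (congrArg some e)) l).symm

/-- Push a symbol to the internal stack `k`. -/
def push {L : Type} (k : S) (f : Store V → Sym) (q : Code S V L) : Code S V L :=
  .push (some k) f q

/-- Pop a symbol from the internal stack `k`. -/
def pop {L : Type} (k : S) (f : Store V → Option Sym → Store V) (q : Code S V L) : Code S V L :=
  .pop (some k) f q

/-- Read the symbol on top of the internal stack `k`. -/
def peek {L : Type} (k : S) (f : Store V → Option Sym → Store V) (q : Code S V L) : Code S V L :=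
  .peek (some k) f q

section StepAux

variable [DecidableEq S] {L : Type} (k : S) (q : Code S V L) (s : Store V) (st : S → List Sym)

@[simp] theorem stepAux_push (f : Store V → Sym) :
    TM2.stepAux (push k f q) s (extend st) =
      TM2.stepAux q s (extend (Function.update st k (f s :: st k))) := by
  rw [← update_extend]; rfl

@[simp] theorem stepAux_pop (f : Store V → Option Sym → Store V) :
    TM2.stepAux (pop k f q) s (extend st) =
      TM2.stepAux q (f s (st k).head?) (extend (Function.update st k (st k).tail)) := by
  rw [← update_extend]; rfl

@[simp] theorem stepAux_peek (f : Store V → Option Sym → Store V) :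
    TM2.stepAux (peek k f q) s (extend st) = TM2.stepAux q (f s (st k).head?) (extend st) :=
  rfl

end StepAux

/-- A piece of a program: it can be placed into any machine, given an injection of its labels and
a label to continue with. -/
structure Frag (S V : Type) : Type 1 where
  /-- the labels -/
  Λ : Type
  /-- there are finitely many labels -/
  fin : Fintype Λ
  /-- the label at which the execution starts -/
  start : Λ
  /-- the code at each label -/
  code : ∀ L : Type, (Λ → L) → L → Λ → Code S V L

section Steps

variable [DecidableEq S] {L : Type}

/-- The machine `M` goes from one configuration to another in at most `t` steps. -/
def Steps (M : L → Code S V L) (a b : TM2.Cfg (Alph S) L (Store V)) (t : ℕ) : Prop :=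
  ∃ n ≤ t, (flip bind (TM2.step M))^[n] (some a) = some b

theorem Steps.trans {M : L → Code S V L} {a b c : TM2.Cfg (Alph S) L (Store V)} {t u : ℕ}
    (h : Steps M a b t) (h' : Steps M b c u) : Steps M a c (t + u) := by
  obtain ⟨n, hn, e⟩ := h
  obtain ⟨m, hm, e'⟩ := h'
  exact ⟨m + n, by omega, by rw [Function.iterate_add_apply, e, e']⟩

theorem Steps.mono {M : L → Code S V L} {a b : TM2.Cfg (Alph S) L (Store V)} {t u : ℕ}
    (h : Steps M a b t) (htu : t ≤ u) : Steps M a b u := by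
  obtain ⟨n, hn, e⟩ := h
  exact ⟨n, hn.trans htu, e⟩

theorem Steps.single {M : L → Code S V L} {l : L} {s : Store V} {st : ∀ k, List (Alph S k)}
    {b : TM2.Cfg (Alph S) L (Store V)} (h : TM2.stepAux (M l) s st = b) :
    Steps M ⟨some l, s, st⟩ b 1 :=
  ⟨1, le_rfl, by subst h; rfl⟩

end Steps

/-! ### Program fragments: composition, branches, loops, and loops over symbols -/

section Runs

variable [DecidableEq S]

/-- Started in the store `s` with the stacks `st`, the fragment `p` ends within `t` steps in the
store `s'` with the stacks `st'`. -/
def Runs (p : Frag S V) (s : Store V) (st : S → List Sym) (s' : Store V) (st' : S → List Sym)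
    (t : ℕ) : Prop :=
  ∀ (L : Type) (inj : p.Λ → L) (exit : L) (M : L → Code S V L),
    (∀ l, M (inj l) = p.code L inj exit l) →
      Steps M ⟨some (inj p.start), s, extend st⟩ ⟨some exit, s', extend st'⟩ t

variable {p q : Frag S V} {s s' s'' : Store V} {st st' st'' : S → List Sym} {t u : ℕ}

theorem Runs.mono (h : Runs p s st s' st' t) (htu : t ≤ u) : Runs p s st s' st' u :=
  fun L inj exit M hM => (h L inj exit M hM).mono htu

/-- `p` followed by `q`. -/
def Frag.seq (p q : Frag S V) : Frag S V where
  Λ := p.Λ ⊕ q.Λ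
  fin := by have := p.fin; have := q.fin; infer_instance
  start := .inl p.start
  code L inj exit := Sum.elim (p.code L (inj ∘ .inl) (inj (.inr q.start)))
    (q.code L (inj ∘ .inr) exit)

/-- `Runs` quantifies over all machines that contain the fragment, so both runs can be taken in one
host, where the exit label of `p` is the start label of `q`. No simulation between machines is
needed. -/
theorem Runs.seq (h : Runs p s st s' st' t) (h' : Runs q s' st' s'' st'' u) :
    Runs (p.seq q) s st s'' st'' (t + u) := fun L inj exit M hM =>
  (h L (inj ∘ .inl) (inj (.inr q.start)) M fun l => hM (.inl l)).trans
    (h' L (inj ∘ .inr) exit M fun l => hM (.inr l))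

/-- A fragment with a single label. -/
def Frag.single (code : ∀ L : Type, L → L → Code S V L) : Frag S V where
  Λ := Unit
  fin := inferInstance
  start := ()
  code L inj exit _ := code L (inj ()) exit

theorem Runs.single_exit {code : ∀ L : Type, L → L → Code S V L}
    (h : ∀ L self exit, TM2.stepAux (code L self exit) s (extend st) = ⟨some exit, s', extend st'⟩) :
    Runs (.single code) s st s' st' 1 := fun L inj exit M hM =>
  Steps.single (by rw [hM]; exact h _ _ _)

theorem Runs.single_loop {code : ∀ L : Type, L → L → Code S V L}
    (h : ∀ L self exit, TM2.stepAux (code L self exit) s (extend st) = ⟨some self, s', extend st'⟩)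
    (h' : Runs (.single code) s' st' s'' st'' t) :
    Runs (.single code) s st s'' st'' (t + 1) := fun L inj exit M hM =>
  ((Steps.single (by rw [hM]; exact h _ _ _)).trans (h' L inj exit M hM)).mono (by omega)

/-- Change the flags by `f`. -/
def Frag.load (f : V → V) : Frag S V :=
  .single fun _ _ exit => .load (fun s => { s with v := f s.v }) (.goto fun _ => exit)

theorem runs_load (f : V → V) (v : V) (st : S → List Sym) :
    Runs (.load f) (rest v) st (rest (f v)) st 1 :=
  Runs.single_exit fun _ _ _ => rfl

/-- `p` if the flags satisfy `c`, and `q` otherwise. -/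
def Frag.ite (c : V → Bool) (p q : Frag S V) : Frag S V where
  Λ := Option (p.Λ ⊕ q.Λ)
  fin := by have := p.fin; have := q.fin; infer_instance
  start := none
  code L inj exit
    | none => .branch (fun s => c s.v) (.goto fun _ => inj (some (.inl p.start)))
        (.goto fun _ => inj (some (.inr q.start)))
    | some (.inl l) => p.code L (inj ∘ some ∘ .inl) exit l
    | some (.inr l) => q.code L (inj ∘ some ∘ .inr) exit l

theorem Runs.ite_true {c : V → Bool} {v : V} (hc : c v = true)
    (h : Runs p (rest v) st s' st' t) : Runs (.ite c p q) (rest v) st s' st' (t + 1) :=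
  fun L inj exit M hM => ((Steps.single (by
      rw [show M (inj (Frag.ite c p q).start) = _ from hM none]
      simp [Frag.ite, rest, hc]
      rfl)).trans
    (h L (inj ∘ some ∘ .inl) exit M fun l => hM (some (.inl l)))).mono (by omega)

theorem Runs.ite_false {c : V → Bool} {v : V} (hc : c v = false)
    (h : Runs q (rest v) st s' st' t) : Runs (.ite c p q) (rest v) st s' st' (t + 1) :=
  fun L inj exit M hM => ((Steps.single (by
      rw [show M (inj (Frag.ite c p q).start) = _ from hM none]
      simp [Frag.ite, rest, hc]
      rfl)).trans
    (h L (inj ∘ some ∘ .inr) exit M fun l => hM (some (.inr l)))).mono (by omega)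

/-- Repeat `p` as long as the stack `k` is not empty. -/
def Frag.whileNE (k : S) (p : Frag S V) : Frag S V where
  Λ := Option p.Λ
  fin := by have := p.fin; infer_instance
  start := none
  code L inj exit
    | none => peek k (fun s a => { s with x := a }) <|
        .branch (fun s => s.x.isSome)
          (.load (fun s => rest s.v) (.goto fun _ => inj (some p.start)))
          (.load (fun s => rest s.v) (.goto fun _ => exit))
    | some l => p.code L (inj ∘ some) (inj none) l

theorem Runs.whileNE_nil {k : S} {v : V} (hk : st k = []) :
    Runs (.whileNE k p) (rest v) st (rest v) st 1 := fun L inj exit M hM => Steps.single (by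
  rw [show M (inj (Frag.whileNE k p).start) = _ from hM none]
  simp [Frag.whileNE, rest, hk])

theorem Runs.whileNE_cons {k : S} {v : V} (hk : st k ≠ []) (h : Runs p (rest v) st s' st' t)
    (h' : Runs (.whileNE k p) s' st' s'' st'' u) :
    Runs (.whileNE k p) (rest v) st s'' st'' (t + u + 1) := fun L inj exit M hM =>
  (((Steps.single (by
      obtain ⟨a, l, hal⟩ := List.exists_cons_of_ne_nil hk
      rw [show M (inj (Frag.whileNE k p).start) = _ from hM none]
      simp [Frag.whileNE, rest, hal]
      rfl)).trans
    (h L (inj ∘ some) (inj none) M fun l => hM (some l))).trans (h' L inj exit M hM)).mono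
      (by omega)

/-- Move the symbols on top of the stack `k` to the stack `j`, up to the first separator, which is
dropped. -/
def Frag.unload (k j : S) : Frag S V := .single fun _ self exit =>
  pop k (fun s a => { s with x := a }) <|
    .branch (fun s => (s.x.getD none).isSome)
      (push j (fun s => s.x.getD none) (.goto fun _ => self))
      (.load (fun s => rest s.v) (.goto fun _ => exit))

/-- Drop the symbols on top of the stack `k`, up to and including the first separator. -/
def Frag.drop (k : S) : Frag S V := .single fun _ self exit =>
  pop k (fun s a => { s with x := a }) <|
    .branch (fun s => (s.x.getD none).isSome) (.goto fun _ => self)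
      (.load (fun s => rest s.v) (.goto fun _ => exit))

/-- Push a separator to the stacks `k` and `j`. -/
def Frag.separate (k j : S) : Frag S V := .single fun _ _ exit =>
  push k (fun _ => none) <| push j (fun _ => none) <|
    .goto fun _ => exit

/-- Move all symbols of the stack `i` to each of the stacks `k` and `j`. -/
def Frag.reload (i k j : S) : Frag S V := .single fun _ self exit =>
  pop i (fun s a => { s with x := a }) <|
    .branch (fun s => s.x.isSome)
      (push k (fun s => s.x.getD none) <| push j (fun s => s.x.getD none) <|
        .goto fun _ => self)
      (.load (fun s => rest s.v) (.goto fun _ => exit))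

/-- Empty the stacks `k` and `j` and change the flags by `f` according to whether the contents were
equal. -/
def Frag.compare (k j : S) (f : V → Bool → V) : Frag S V := .single fun _ self exit =>
  pop k (fun s a => { s with x := a }) <| pop j (fun s a => { s with y := a }) <|
    .branch (fun s => s.x.isSome || s.y.isSome)
      (.load (fun s => { s with eq := s.eq && s.x = s.y }) (.goto fun _ => self))
      (.load (fun s => rest (f s.v s.eq)) (.goto fun _ => exit))

-- Induction on the word. The store is not required to be `rest v`, because after one round the
-- register `x` still holds the bit just moved. The word arrives reversed on `j`.
open Function in
theorem runs_unload {k j : S} (hkj : k ≠ j) (v : V) (l : List Sym) (w : List Bool) :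
    ∀ (s : Store V) (st : S → List Sym), s.v = v → s.y = none → s.eq = true →
      st k = w.map some ++ none :: l →
      Runs (.unload k j) s st (rest v)
        (update (update st j ((w.map some).reverse ++ st j)) k l) (w.length + 1) := by
  induction w with
  | nil =>
    rintro ⟨x, y, b, v⟩ st rfl hy hb hk
    refine Runs.single_exit fun L self exit => ?_
    simp at hk
    simp [hk, rest]
  | cons b w ih =>
    rintro ⟨x, y, b', v⟩ st rfl hy hb hk
    simp at hy hb
    subst hy hb
    have := ih ⟨some (some b), none, true, v⟩
      (update (update st k (w.map some ++ none :: l)) j (some b :: st j)) rfl rfl rfl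
      (by simp [hkj])
    refine Runs.single_loop (s' := ⟨some (some b), none, true, v⟩) (st' :=
      (update (update st k (w.map some ++ none :: l)) j (some b :: st j))) ?_ ?_
    · intro L self exit
      simp at hk
      simp [hk, hkj.symm]
    · change Runs (.unload k j) _ _ _ _ _
      convert this using 1
      swap
      · rfl
      funext i
      by_cases hj : i = j
      · subst hj; simp [hkj.symm]
      · by_cases hk : i = k
        · subst hk; simp
        · simp [hj, hk]

open Function in
theorem runs_drop (k : S) (v : V) (l : List Sym) (w : List Bool) :
    ∀ (s : Store V) (st : S → List Sym), s.v = v → st k = w.map some ++ none :: l →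
      Runs (.drop k) s st (rest v) (update st k l) (w.length + 1) := by
  induction w with
  | nil =>
    rintro ⟨x, y, b, v⟩ st rfl hk
    refine Runs.single_exit fun L self exit => ?_
    simp at hk
    simp [hk]
  | cons b w ih =>
    rintro ⟨x, y, b', v⟩ st rfl hk
    have := ih ⟨some (some b), y, b', v⟩ (update st k (w.map some ++ none :: l)) rfl (by simp)
    rw [update_idem] at this
    refine Runs.single_loop ?_ this
    intro L self exit
    simp at hk
    simp [hk]

open Function in
theorem runs_separate {k j : S} (hkj : k ≠ j) (v : V) (st : S → List Sym) :
    Runs (.separate k j) (rest v) st (rest v)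
      (update (update st k (none :: st k)) j (none :: st j)) 1 :=
  Runs.single_exit fun L self exit => by simp [hkj.symm]

open Function in
theorem runs_reload {i k j : S} (hik : i ≠ k) (hij : i ≠ j) (hkj : k ≠ j) (v : V) (w : List Sym) :
    ∀ (s : Store V) (st : S → List Sym), s.v = v → st i = w →
      Runs (.reload i k j) s st (rest v)
        (update (update (update st k (w.reverse ++ st k)) j (w.reverse ++ st j)) i [])
        (w.length + 1) := by
  induction w with
  | nil =>
    rintro ⟨x, y, b, v⟩ st rfl hk
    refine Runs.single_exit fun L self exit => ?_
    simp [hk]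
  | cons b w ih =>
    rintro ⟨x, y, b', v⟩ st rfl hk
    have := ih ⟨some b, y, b', v⟩
      (update (update (update st i w) k (b :: st k)) j (b :: st j)) rfl (by simp [hik, hij])
    refine Runs.single_loop (s' := ⟨some b, y, b', v⟩) (st' :=
      (update (update (update st i w) k (b :: st k)) j (b :: st j))) ?_ ?_
    · intro L self exit
      simp [hk, hik.symm, hij.symm, hkj.symm]
    · change Runs (.reload i k j) _ _ _ _ _
      convert this using 1
      swap
      · rfl
      funext a
      by_cases h1 : a = i
      · subst h1; simp
      · by_cases h2 : a = j
        · subst h2; simp [h1]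
        · by_cases h3 : a = k
          · subst h3; simp [h1, h2]
          · simp [h1, h2, h3]

-- Induction on a common bound `n` for both lengths: popping an exhausted stack leaves it empty and
-- reads `none`, which differs from every symbol. The loop goes on after a mismatch, so both stacks
-- end empty in every case.
open Function in
theorem runs_compare {k j : S} (hkj : k ≠ j) (f : V → Bool → V) (v : V) :
    ∀ (n : ℕ) (w u : List Sym) (s : Store V) (st : S → List Sym), w.length ≤ n → u.length ≤ n →
      s.v = v → st k = w → st j = u →
      Runs (.compare k j f) s st (rest (f v (s.eq && (w = u : Bool))))
        (update (update st k []) j []) (n + 1) := by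
  intro n
  induction n with
  | zero =>
    rintro w u ⟨x, y, b, v⟩ st hw hu rfl rfl rfl
    rw [Nat.le_zero, List.length_eq_zero_iff] at hw hu
    refine Runs.single_exit fun L self exit => ?_
    simp [hkj.symm, hw, hu]
  | succ n ih =>
    rintro w u ⟨x, y, b, v⟩ st hw hu rfl rfl rfl
    by_cases h : st k = [] ∧ st j = []
    · refine Runs.mono (t := 1) (Runs.single_exit fun L self exit => ?_) (by omega)
      simp [hkj.symm, h.1, h.2]
    have := ih (st k).tail (st j).tail
      ⟨(st k).head?, (st j).head?, b && ((st k).head? = (st j).head? : Bool), v⟩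
      (update (update st k (st k).tail) j (st j).tail)
      (by simpa using hw) (by simpa using hu) rfl (by simp [hkj]) (by simp)
    -- Two lists agree iff their optional heads and their tails do; this also covers the case that
    -- exactly one of them is empty.
    have e : (b && decide (st k = st j)) =
        ((b && decide ((st k).head? = (st j).head?)) && decide ((st k).tail = (st j).tail)) := by
      rw [Bool.eq_iff_iff]
      cases st k <;> cases st j <;> simp [and_assoc]
      exact fun _ _ => decide_eq_true_iff.symm
    refine Runs.single_loop (s' :=
      ⟨(st k).head?, (st j).head?, b && ((st k).head? = (st j).head? : Bool), v⟩) (st' :=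
      (update (update st k (st k).tail) j (st j).tail)) ?_ ?_
    · intro L self exit
      have : ((st k).head?.isSome || (st j).head?.isSome) = true := by
        revert h
        cases st k <;> cases st j <;> simp
      simp [hkj.symm, this]
    · simp only at this ⊢
      rw [e]
      change Runs (.compare k j f) _ _ _ _ _
      convert this using 1
      funext a
      by_cases h1 : a = j
      · subst h1; simp
      · by_cases h2 : a = k
        · subst h2; simp [h1]
        · simp [h1, h2]

end Runs

end StackMachine

/-! ### Columns of binary numbers -/

namespace StackMachine

open Function

/-- The internal stacks of a machine that works on the columns `C`: the columns, and three auxiliary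
stacks. -/
abbrev Stacks (C : Type) : Type := C ⊕ Fin 3

variable {C V : Type}

/-- The stacks, when the columns hold the numbers `ws` and the auxiliary stacks are empty. -/
def lay (ws : C → List ℕ) : Stacks C → List Sym
  | .inl c => (ws c).flatMap encodeNumber
  | .inr _ => []

theorem update_lay [DecidableEq C] (ws : C → List ℕ) (c : C) (l : List ℕ) :
    update (lay ws) (.inl c) (l.flatMap encodeNumber) = lay (update ws c l) := by
  funext j
  rcases j with j | j
  · by_cases h : j = c
    · subst h; simp [lay]
    · simp [lay, h]
  · simp [lay]

theorem lay_cons {ws : C → List ℕ} {c : C} {d : ℕ} {l : List ℕ} (h : ws c = d :: l) :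
    lay ws (.inl c) = (Nat.bits d).map some ++ none :: l.flatMap encodeNumber := by
  simp [lay, h, encodeNumber]

theorem lay_eq_nil {ws : C → List ℕ} {c : C} : lay ws (.inl c) = [] ↔ ws c = [] := by
  cases h : ws c <;> simp [lay, h, encodeNumber]

variable [DecidableEq C]

/-- Started with the flags `v` and the columns `ws`, the fragment `p` ends within `t` steps with
the flags `v'` and the columns `ws'`. -/
def Exec (p : Frag (Stacks C) V) (v : V) (ws : C → List ℕ) (v' : V) (ws' : C → List ℕ) (t : ℕ) :
    Prop :=
  Runs p (rest v) (lay ws) (rest v') (lay ws') t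

variable {p q : Frag (Stacks C) V} {v v' v'' : V} {ws ws' ws'' : C → List ℕ} {t u N : ℕ}

theorem Exec.mono (h : Exec p v ws v' ws' t) (htu : t ≤ u) : Exec p v ws v' ws' u :=
  Runs.mono h htu

theorem Exec.seq (h : Exec p v ws v' ws' t) (h' : Exec q v' ws' v'' ws'' u) :
    Exec (p.seq q) v ws v'' ws'' (t + u) :=
  Runs.seq h h'

/-- Drop the top number of a column. -/
def dropNum (c : C) : Frag (Stacks C) V := .drop (.inl c)

/-- Copy the top number of the column `c` to one of the auxiliary stacks or to another column. -/
def copyNum (c : C) (k : Stacks C) : Frag (Stacks C) V :=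
  (Frag.unload (.inl c) (.inr 0)).seq ((Frag.separate (.inl c) k).seq (.reload (.inr 0) (.inl c) k))

/-- Move the top number of the column `c` to the column `e`. -/
def moveNum (c e : C) : Frag (Stacks C) V := (copyNum c (.inl e)).seq (dropNum c)

/-- Change the flags by `f` according to whether the top numbers of two columns are equal. -/
def compareNum (c e : C) (f : V → Bool → V) : Frag (Stacks C) V :=
  (copyNum c (.inr 1)).seq ((copyNum e (.inr 2)).seq (.compare (.inr 1) (.inr 2) f))

theorem exec_dropNum {c : C} {d : ℕ} {l : List ℕ} (h : ws c = d :: l)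
    (hd : (Nat.bits d).length ≤ N) : Exec (dropNum c) v ws v (update ws c l) (N + 1) := by
  have := runs_drop (.inl c) v (l.flatMap encodeNumber) (Nat.bits d) (rest v) (lay ws) rfl
    (lay_cons h)
  rw [update_lay] at this
  exact this.mono (by omega)

/-- Two reversals restore the order: the bits go to auxiliary stack 0, a separator is pushed on both
targets, and the bits return on top of it. The stacks are arbitrary, not of the form `lay ws`,
because a comparison makes its second copy while an auxiliary stack is in use. -/
theorem runs_copyNum {c : C} {k : Stacks C} (hk : k ≠ .inl c) (hk' : k ≠ .inr 0)
    {st : Stacks C → List Sym} {w : List Bool} {l : List Sym}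
    (h : st (.inl c) = w.map some ++ none :: l) (h0 : st (.inr 0) = []) (hd : w.length ≤ N) :
    Runs (copyNum c k) (rest v) st (rest v) (update st k (w.map some ++ none :: st k))
      (2 * N + 3) := by
  have h1 := runs_unload (k := .inl c) (j := .inr 0) (by simp) v l w (rest v) st rfl rfl rfl h
  have h2 := runs_separate hk.symm v (update (update st (.inr 0) ((w.map some).reverse ++ st (.inr 0)))
    (.inl c) l)
  have h3 := runs_reload (i := .inr 0) (k := .inl c) (j := k) (by simp) hk'.symm hk.symm v _ _ _
    rfl rfl |> h2.seq |> h1.seq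
  refine Runs.mono (t := w.length + 1 + (1 + (w.length + 1))) ?_ (by omega)
  rw [copyNum]
  convert h3 using 1
  · funext a
    by_cases e1 : a = k
    · subst e1; simp [hk, hk', h0, hk'.symm]
    · by_cases e2 : a = .inl c
      · subst e2; simp [h0, h, hk.symm, hk'.symm]
      · by_cases e3 : a = .inr 0
        · subst e3; simp [h0, e1]
        · simp [e1, e2, e3]
  · simp [h0, hk'.symm]

theorem exec_copyNum {c e : C} {d : ℕ} {l : List ℕ} (h : ws c = d :: l) (hce : e ≠ c)
    (hd : (Nat.bits d).length ≤ N) :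
    Exec (copyNum c (.inl e)) v ws v (update ws e (d :: ws e)) (2 * N + 3) := by
  have := runs_copyNum (v := v) (k := .inl e) (by simpa using hce) (by simp) (lay_cons h) rfl hd
  rw [Exec, ← update_lay]
  simpa [lay, encodeNumber] using this

theorem exec_moveNum {c e : C} {d : ℕ} {l : List ℕ} (h : ws c = d :: l) (hce : e ≠ c)
    (hd : (Nat.bits d).length ≤ N) :
    Exec (moveNum c e) v ws v (update (update ws e (d :: ws e)) c l) (3 * N + 4) :=
  ((exec_copyNum h hce hd).seq (exec_dropNum (by simpa [hce.symm] using h) hd)).mono (by omega)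

theorem bits_injective : Injective Nat.bits := fun a b h => by
  rw [← Nat.ofDigits_digits 2 a, ← Nat.ofDigits_digits 2 b, Nat.digits_two_eq_bits,
    Nat.digits_two_eq_bits, h]

theorem exec_compareNum {c e : C} {d d' : ℕ} {l l' : List ℕ} (h : ws c = d :: l)
    (h' : ws e = d' :: l') (hd : (Nat.bits d).length ≤ N) (hd' : (Nat.bits d').length ≤ N)
    (f : V → Bool → V) :
    Exec (compareNum c e f) v ws (f v (d = d' : Bool)) ws (5 * N + 8) := by
  have h1 := runs_copyNum (v := v) (k := .inr 1) (by simp) (by simp) (lay_cons h) rfl hd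
  have h2 := runs_copyNum (v := v) (c := e) (k := .inr 2) (by simp) (by simp)
    (st := update (lay ws) (.inr 1) ((Nat.bits d).map some ++ none :: lay ws (.inr 1)))
    (by simpa using lay_cons h') rfl hd'
  -- The bound is `N + 1` because the copied words include their separators.
  have h3 := runs_compare (k := (.inr 1 : Stacks C)) (j := .inr 2) (by simp) f v (N + 1)
    ((Nat.bits d).map some ++ [none]) ((Nat.bits d').map some ++ [none]) (rest v)
    (update (update (lay ws) (.inr 1) ((Nat.bits d).map some ++ none :: lay ws (.inr 1))) (.inr 2)
      ((Nat.bits d').map some ++ none :: update (lay ws) (.inr 1)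
        ((Nat.bits d).map some ++ none :: lay ws (.inr 1)) (.inr 2)))
    (by simpa using hd) (by simpa using hd') rfl (by simp [lay]) (by simp [lay])
  have h4 := (h1.seq (h2.seq h3)).mono (show _ ≤ 5 * N + 8 by omega)
  rw [Exec, compareNum]
  convert h4 using 1
  · congr 2
    simp only [rest, Bool.true_and, decide_eq_decide]
    constructor
    · rintro rfl; rfl
    · intro h
      exact bits_injective (List.map_injective_iff.2 (Option.some_injective _) (by simpa using h))
  · funext a
    by_cases e1 : a = .inr 2
    · subst e1; simp [lay]
    · by_cases e2 : a = .inr 1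
      · subst e2; simp [lay]
      · simp [e1, e2]

theorem exec_load (f : V → V) : Exec (.load f) v ws (f v) ws 1 := runs_load f v _

theorem Exec.ite_true {c : V → Bool} (hc : c v = true) (h : Exec p v ws v' ws' t) :
    Exec (.ite c p q) v ws v' ws' (t + 1) := Runs.ite_true hc h

theorem Exec.ite_false {c : V → Bool} (hc : c v = false) (h : Exec q v ws v' ws' t) :
    Exec (.ite c p q) v ws v' ws' (t + 1) := Runs.ite_false hc h

theorem Exec.whileNE_nil {c : C} (h : ws c = []) : Exec (.whileNE (.inl c) p) v ws v ws 1 :=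
  Runs.whileNE_nil (lay_eq_nil.2 h)

theorem Exec.whileNE_cons {c : C} (hc : ws c ≠ []) (h : Exec p v ws v' ws' t)
    (h' : Exec (.whileNE (.inl c) p) v' ws' v'' ws'' u) :
    Exec (.whileNE (.inl c) p) v ws v'' ws'' (t + u + 1) :=
  Runs.whileNE_cons (fun e => hc (lay_eq_nil.1 e)) h h'

end StackMachine

/-! ### Registers of records with three fields -/

namespace StackMachine

open Function

/-- The registers of the search program; each of them holds a list of records. -/
inductive Reg
  | todo | past | queue | unseen | aside | cur
  deriving DecidableEq

instance : Fintype Reg :=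
  ⟨{.todo, .past, .queue, .unseen, .aside, .cur}, fun x => by cases x <;> decide⟩

/-- The columns: the input, and three columns for each register. -/
abbrev Col : Type := Option (Reg × Fin 3)

variable {α V : Type} {field : α → Fin 3 → ℕ}

/-- The contents of the columns, when the registers hold `rs` and the input has been read up to
`inp`. -/
def columns (field : α → Fin 3 → ℕ) (inp : List ℕ) (rs : Reg → List α) : Col → List ℕ
  | none => inp
  | some (x, i) => (rs x).map (field · i)

/-- Execute a fragment for each of the three fields of a record. -/
def eachField (p : Fin 3 → Frag (Stacks Col) V) : Frag (Stacks Col) V :=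
  (p 0).seq ((p 1).seq (p 2))

/-- Copy the top record of the register `x` to the register `y`. -/
def copyRec (x y : Reg) : Frag (Stacks Col) V :=
  eachField fun i => copyNum (some (x, i)) (.inl (some (y, i)))

/-- Move the top record of the register `x` to the register `y`. -/
def moveRec (x y : Reg) : Frag (Stacks Col) V :=
  eachField fun i => moveNum (some (x, i)) (some (y, i))

/-- Drop the top record of the register `x`. -/
def dropRec (x : Reg) : Frag (Stacks Col) V :=
  eachField fun i => dropNum (some (x, i))

/-- Move a record from the input to the register `x`. -/
def readRec (x : Reg) : Frag (Stacks Col) V :=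
  eachField fun i => moveNum none (some (x, i))

/-- Compare a field of the top record of the register `x` with a field of the top record of the
register `y`. -/
def compareRec (x : Reg) (i : Fin 3) (y : Reg) (j : Fin 3) (f : V → Bool → V) :
    Frag (Stacks Col) V :=
  compareNum (some (x, i)) (some (y, j)) f

/-- Started with the flags `v` and the registers `rs`, the fragment `p` ends within `t` steps with
the flags `v'` and the registers `rs'`. -/
def ExecR (field : α → Fin 3 → ℕ) (p : Frag (Stacks Col) V) (v : V) (rs : Reg → List α) (v' : V)
    (rs' : Reg → List α) (t : ℕ) : Prop :=
  Exec p v (columns field [] rs) v' (columns field [] rs') t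

variable {p q : Frag (Stacks Col) V} {v v' v'' : V} {rs rs' rs'' : Reg → List α} {t u N : ℕ}
  {x y : Reg} {a b : α} {l l' : List α}

theorem ExecR.mono (h : ExecR field p v rs v' rs' t) (htu : t ≤ u) : ExecR field p v rs v' rs' u :=
  Exec.mono h htu

theorem ExecR.seq (h : ExecR field p v rs v' rs' t) (h' : ExecR field q v' rs' v'' rs'' u) :
    ExecR field (p.seq q) v rs v'' rs'' (t + u) :=
  Exec.seq h h'

/-- Repeat `p` as long as the register `x` is not empty. -/
def whileReg (x : Reg) (p : Frag (Stacks Col) V) : Frag (Stacks Col) V :=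
  .whileNE (.inl (some (x, 0))) p

/-- The three columns of a register have the same length, so column 0 alone tells whether it is
empty. -/
theorem ExecR.while_nil (h : rs x = []) : ExecR field (whileReg x p) v rs v rs 1 :=
  Exec.whileNE_nil (by simp [columns, h])

theorem ExecR.while_cons (hx : rs x = a :: l) (h : ExecR field p v rs v' rs' t)
    (h' : ExecR field (whileReg x p) v' rs' v'' rs'' u) :
    ExecR field (whileReg x p) v rs v'' rs'' (t + u + 1) :=
  Exec.whileNE_cons (by simp [columns, hx]) h h'

/-- The bound `16 * (N + 1)` serves all record operations; the most expensive one, moving, needs `3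
* (3 * N + 4)`. -/
theorem exec_copyRec (hN : ∀ a i, (Nat.bits (field a i)).length ≤ N) (h : rs x = a :: l)
    (hxy : x ≠ y) :
    ExecR field (copyRec x y) v rs v (update rs y (a :: rs y)) (16 * (N + 1)) := by
  have h0 := exec_copyNum (v := v) (ws := columns field [] rs) (c := some (x, 0)) (e := some (y, 0))
    (d := field a 0) (l := l.map (field · 0)) (by simp [columns, h]) (by simpa using hxy.symm)
    (hN _ _)
  have h1 := h0.seq (exec_copyNum (c := some (x, 1)) (e := some (y, 1)) (d := field a 1)
    (l := l.map (field · 1)) (by simp [columns, h]) (by simpa using hxy.symm) (hN _ _) |>.seq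
      (exec_copyNum (c := some (x, 2)) (e := some (y, 2)) (d := field a 2)
    (l := l.map (field · 2)) (by simp [columns, h]) (by simpa using hxy.symm) (hN _ _)))
  rw [ExecR, copyRec, eachField]
  convert h1.mono (show _ ≤ 16 * (N + 1) by omega) using 1
  funext c
  rcases c with _ | ⟨z, i⟩
  · simp [columns]
  · by_cases hz : z = y
    · subst hz
      fin_cases i <;> simp [columns]
    · simp [columns, hz]

theorem exec_moveRec (hN : ∀ a i, (Nat.bits (field a i)).length ≤ N) (h : rs x = a :: l)
    (hxy : x ≠ y) :
    ExecR field (moveRec x y) v rs v (update (update rs y (a :: rs y)) x l) (16 * (N + 1)) := by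
  have h0 := exec_moveNum (v := v) (ws := columns field [] rs) (c := some (x, 0)) (e := some (y, 0))
    (d := field a 0) (l := l.map (field · 0)) (by simp [columns, h]) (by simpa using hxy.symm)
    (hN _ _)
  have h1 := h0.seq (exec_moveNum (c := some (x, 1)) (e := some (y, 1)) (d := field a 1)
    (l := l.map (field · 1)) (by simp [columns, h]) (by simpa using hxy.symm) (hN _ _) |>.seq
      (exec_moveNum (c := some (x, 2)) (e := some (y, 2)) (d := field a 2)
    (l := l.map (field · 2)) (by simp [columns, h]) (by simpa using hxy.symm) (hN _ _)))
  rw [ExecR, moveRec, eachField]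
  convert h1.mono (show _ ≤ 16 * (N + 1) by omega) using 1
  funext c
  rcases c with _ | ⟨z, i⟩
  · simp [columns]
  · by_cases hz : z = x
    · subst hz
      fin_cases i <;> simp [columns]
    · by_cases hz' : z = y
      · subst hz'
        fin_cases i <;> simp [columns, hz]
      · simp [columns, hz, hz']

theorem exec_dropRec (hN : ∀ a i, (Nat.bits (field a i)).length ≤ N) (h : rs x = a :: l) :
    ExecR field (dropRec x) v rs v (update rs x l) (16 * (N + 1)) := by
  have h0 := exec_dropNum (v := v) (ws := columns field [] rs) (c := some (x, 0))
    (d := field a 0) (l := l.map (field · 0)) (by simp [columns, h]) (hN _ _)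
  have h1 := h0.seq (exec_dropNum (c := some (x, 1)) (d := field a 1)
    (l := l.map (field · 1)) (by simp [columns, h]) (hN _ _) |>.seq
      (exec_dropNum (c := some (x, 2)) (d := field a 2)
    (l := l.map (field · 2)) (by simp [columns, h]) (hN _ _)))
  rw [ExecR, dropRec, eachField]
  convert h1.mono (show _ ≤ 16 * (N + 1) by omega) using 1
  funext c
  rcases c with _ | ⟨z, i⟩
  · simp [columns]
  · by_cases hz : z = x
    · subst hz
      fin_cases i <;> simp [columns]
    · simp [columns, hz]

theorem exec_readRec (hN : ∀ a i, (Nat.bits (field a i)).length ≤ N) {inp : List ℕ} :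
    Exec (readRec x) v (columns field (field a 0 :: field a 1 :: field a 2 :: inp) rs) v
      (columns field inp (update rs x (a :: rs x))) (16 * (N + 1)) := by
  have h0 := exec_moveNum (v := v)
    (ws := columns field (field a 0 :: field a 1 :: field a 2 :: inp) rs) (c := none)
    (e := some (x, 0)) (d := field a 0) (l := field a 1 :: field a 2 :: inp) rfl (by simp) (hN _ _)
  have h1 := h0.seq (exec_moveNum (c := none) (e := some (x, 1)) (d := field a 1)
    (l := field a 2 :: inp) (by simp) (by simp) (hN _ _) |>.seq
      (exec_moveNum (c := none) (e := some (x, 2)) (d := field a 2)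
    (l := inp) (by simp) (by simp) (hN _ _)))
  rw [readRec, eachField]
  convert h1.mono (show _ ≤ 16 * (N + 1) by omega) using 1
  funext c
  rcases c with _ | ⟨z, i⟩
  · simp [columns]
  · by_cases hz : z = x
    · subst hz
      fin_cases i <;> simp [columns]
    · simp [columns, hz]

theorem exec_compareRec (hN : ∀ a i, (Nat.bits (field a i)).length ≤ N) (h : rs x = a :: l)
    (h' : rs y = b :: l') (i j : Fin 3) (f : V → Bool → V) :
    ExecR field (compareRec x i y j f) v rs (f v (field a i = field b j : Bool)) rs
      (5 * N + 8) :=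
  exec_compareNum (l := l.map (field · i)) (l' := l'.map (field · j)) (by simp [columns, h])
    (by simp [columns, h']) (hN _ _) (hN _ _) f

/-- Move all records of the register `x` to the register `y`. -/
def spill (x y : Reg) : Frag (Stacks Col) V := whileReg x (moveRec x y)

theorem exec_spill (hN : ∀ a i, (Nat.bits (field a i)).length ≤ N) (hxy : x ≠ y) :
    ∀ (l : List α) (rs : Reg → List α), rs x = l →
      ExecR field (spill x y) v rs v (update (update rs y (l.reverse ++ rs y)) x [])
        (l.length * (16 * (N + 1) + 1) + 1) := by
  intro l
  induction l with
  | nil =>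
    intro rs h
    rw [spill]
    convert ExecR.while_nil (p := moveRec x y) h using 1
    · funext z
      by_cases hz : z = x
      · subst hz; simp [h]
      · simp [hz]
    · simp
  | cons a l ih =>
    intro rs h
    have := ExecR.while_cons h (exec_moveRec hN h hxy) (ih _ (by simp))
    rw [spill]
    convert this using 1
    · funext z
      by_cases hz : z = x
      · subst hz; simp
      · by_cases hz' : z = y
        · subst hz'; simp [hz]
        · simp [hz, hz']
    · simp; ring

/-! ### The search program -/

section Program

/-- The two flags of the program: the outcome of the last test, and whether no failure has been
found so far. -/
abbrev Flags : Type := Bool × Bool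

/-- Check whether the top record of `x` could close a trail that starts with the top record of
`queue` in a way that violates the coloring. -/
def closingTest (pc : Bool) (x : Reg) : Frag (Stacks Col) Flags :=
  (compareRec x 1 .queue 0 fun v b => (b, v.2)).seq
    (compareRec x 2 .queue 2 fun v b => (false, v.2 && !(pc && v.1 && b)))

/-- Check all records of `x` by `closingTest`, and copy them to `unseen`. -/
def scan (pc : Bool) (x : Reg) : Frag (Stacks Col) Flags :=
  (whileReg x ((closingTest pc x).seq ((copyRec x .unseen).seq (moveRec x .aside)))).seq
    (spill .aside x)

/-- Check whether the top record of `unseen` can follow the top record of `cur`. -/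
def followTest : Frag (Stacks Col) Flags :=
  (compareRec .cur 1 .unseen 0 fun v b => (b, v.2)).seq
    (compareRec .cur 2 .unseen 2 fun v b => (v.1 && !b, v.2))

/-- Move the records of `unseen` which can follow the top record of `cur` to `queue`, and the others
to `aside`. -/
def distribute : Frag (Stacks Col) Flags :=
  whileReg .unseen (followTest.seq
    ((Frag.ite Prod.fst (moveRec .unseen .queue) (moveRec .unseen .aside)).seq
      (.load fun v => (false, v.2))))

/-- Take a record from `queue`, and move all its unseen successors to `queue`. -/
def expand : Frag (Stacks Col) Flags :=
  (moveRec .queue .cur).seq (distribute.seq ((spill .aside .unseen).seq (dropRec .cur)))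

/-- Breadth-first search. -/
def search : Frag (Stacks Col) Flags := whileReg .queue expand

/-- Empty `unseen`, and register a failure if it is not empty already. -/
def clearUnseen : Frag (Stacks Col) Flags :=
  whileReg .unseen ((dropRec .unseen).seq (.load fun v => (v.1, false)))

/-- Check whether all trails required from the top record of `todo` exist. -/
def visit (pc : Bool) : Frag (Stacks Col) Flags :=
  (copyRec .todo .queue).seq <| (moveRec .todo .cur).seq <| (scan pc .todo).seq <|
    (scan pc .past).seq <| (moveRec .cur .past).seq <| search.seq clearUnseen

/-- Check whether all trails required from the records of `todo` exist. -/
def visitAll (pc : Bool) : Frag (Stacks Col) Flags :=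
  (whileReg .todo (visit pc)).seq (whileReg .past (dropRec .past))

/-- Read the input, and check whether all required trails exist. -/
def program (pc : Bool) : Frag (Stacks Col) Flags :=
  (dropNum none).seq <| (dropNum none).seq <| (Frag.whileNE (.inl none) (readRec .todo)).seq <|
    visitAll pc

end Program

end StackMachine

/-! ### Correctness and running time of the search -/

namespace StackMachine

open Function

variable {α : Type} {field : α → Fin 3 → ℕ} {rs : Reg → List α} {N : ℕ} {ok : Bool}
  {t p q u a c l : List α}

/-- The record `f` does not close a trail that starts with `e` in a way that violates the
coloring; this is checked only if `pc` is set. -/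
def closesWell (field : α → Fin 3 → ℕ) (pc : Bool) (e f : α) : Bool :=
  !(pc && (field f 1 = field e 0 : Bool) && (field f 2 = field e 2 : Bool))

/-- The record `f` can follow the record `e`. -/
def follows (field : α → Fin 3 → ℕ) (e f : α) : Bool :=
  (field e 1 = field f 0 : Bool) && !(field e 2 = field f 2 : Bool)

theorem exec_scan_loop (hN : ∀ a i, (Nat.bits (field a i)).length ≤ N) (pc : Bool) {x : Reg}
    (hq : x ≠ .queue) (hu : x ≠ .unseen) (ha : x ≠ .aside) (e : α) :
    ∀ (l : List α) (rs : Reg → List α) (ok : Bool), rs x = l → rs .queue = [e] →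
      ExecR field (whileReg x ((closingTest pc x).seq ((copyRec x .unseen).seq (moveRec x .aside))))
        (false, ok) rs (false, ok && l.all (closesWell field pc e))
        (update (update (update rs .unseen (l.reverse ++ rs .unseen))
          .aside (l.reverse ++ rs .aside)) x [])
        (l.length * (48 * (N + 1) + 1) + 1) := by
  intro l
  induction l with
  | nil =>
    intro rs ok h _
    convert ExecR.while_nil h using 1
    · simp
    · funext z
      by_cases hz : z = x
      · subst hz; simp [h]
      · simp [hz]
    · simp
  | cons a l ih =>
    intro rs ok h he
    have := ExecR.while_cons h (((exec_compareRec (v := (false, ok)) hN h he 1 0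
      fun v b => (b, v.2)).seq (exec_compareRec hN h he 2 2
        fun v b => (false, v.2 && !(pc && v.1 && b)))).seq
      ((exec_copyRec hN h hu).seq (exec_moveRec hN (by simpa [hu] using h) ha)))
      (ih _ _ (by simp) (by simp [hq.symm, he]))
    replace this := this.mono (u := (a :: l).length * (48 * (N + 1) + 1) + 1)
      (by simp only [List.length_cons]; ring_nf; omega)
    rw [closingTest]
    convert this using 1
    · simp [closesWell, Bool.and_assoc]
    · funext z
      by_cases hz : z = x
      · subst hz; simp
      · cases z <;> simp_all [hu.symm, ha.symm]

/-- The loop has to consume `x` in order to inspect it. The records pile up reversed on `aside`, and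
spilling them back reverses them again, which restores `x`. -/
theorem exec_scan (hN : ∀ a i, (Nat.bits (field a i)).length ≤ N) (pc : Bool) {x : Reg}
    (hq : x ≠ .queue) (hu : x ≠ .unseen) (ha : x ≠ .aside) {e : α} (he : rs .queue = [e])
    (h : rs .aside = []) :
    ExecR field (scan pc x) (false, ok) rs (false, ok && (rs x).all (closesWell field pc e))
      (update rs .unseen ((rs x).reverse ++ rs .unseen))
      ((rs x).length * (64 * (N + 1) + 2) + 2) := by
  have h1 := exec_scan_loop hN pc hq hu ha e _ rs ok rfl he
  have h2 := exec_spill (v := (false, ok && (rs x).all (closesWell field pc e))) hN ha.symm _ _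
    (show update (update (update rs .unseen ((rs x).reverse ++ rs .unseen))
          .aside ((rs x).reverse ++ rs .aside)) x [] .aside = (rs x).reverse by simp [ha.symm, h])
  have h3 := (h1.seq h2).mono (u := (rs x).length * (64 * (N + 1) + 2) + 2)
    (by simp only [List.length_reverse]; ring_nf; omega)
  rw [scan]
  convert h3 using 1
  funext z
  by_cases hz : z = x
  · subst hz; simp [ha, hu]
  · cases z <;> simp_all

/-- Induction on the unseen records. The test result is reset after each round, so every round
starts with the flags `(false, ok)`. -/
theorem exec_distribute (hN : ∀ a i, (Nat.bits (field a i)).length ≤ N) (e : α) (cs : List α) :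
    ∀ (l : List α) (rs : Reg → List α), rs .unseen = l → rs .cur = e :: cs →
      ExecR field distribute (false, ok) rs (false, ok)
        (update (update (update rs .queue ((l.filter (follows field e)).reverse ++ rs .queue))
          .aside ((l.filter fun f => !follows field e f).reverse ++ rs .aside)) .unseen [])
        (l.length * (32 * (N + 1) + 3) + 1) := by
  intro l
  induction l with
  | nil =>
    intro rs h _
    rw [distribute]
    convert ExecR.while_nil (v := (false, ok)) h using 1
    · funext z
      cases z <;> simp [h]
    · simp
  | cons a l ih =>
    intro rs h he
    have h1 : ExecR field followTest (false, ok) rs (follows field e a, ok) rs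
        (5 * N + 8 + (5 * N + 8)) :=
      (exec_compareRec (v := (false, ok)) hN he h 1 0 fun v b => (b, v.2)).seq
        (exec_compareRec hN he h 2 2 fun v b => (v.1 && !b, v.2))
    rw [distribute]
    cases hf : follows field e a with
    | true =>
      rw [hf] at h1
      have h2 : ExecR field (Frag.ite Prod.fst (moveRec .unseen .queue) (moveRec .unseen .aside))
          (true, ok) rs (true, ok) _ _ :=
        Exec.ite_true rfl (exec_moveRec (field := field) (rs := rs) hN h (by decide))
      have h3 := h2.seq (Exec.mono (exec_load fun v : Flags => (false, v.2)) le_rfl)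
      have := ExecR.while_cons h (h1.seq h3) (ih _ (by simp) (by simp [he]))
      replace this := this.mono (u := (a :: l).length * (32 * (N + 1) + 3) + 1)
        (by simp only [List.length_cons]; ring_nf; omega)
      convert this using 1
      funext z
      cases z <;> simp [hf]
    | false =>
      rw [hf] at h1
      have h2 : ExecR field (Frag.ite Prod.fst (moveRec .unseen .queue) (moveRec .unseen .aside))
          (false, ok) rs (false, ok) _ _ :=
        Exec.ite_false rfl (exec_moveRec (field := field) (rs := rs) hN h (by decide))
      have h3 := h2.seq (Exec.mono (exec_load fun v : Flags => (false, v.2)) le_rfl)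
      have := ExecR.while_cons h (h1.seq h3) (ih _ (by simp) (by simp [he]))
      replace this := this.mono (u := (a :: l).length * (32 * (N + 1) + 3) + 1)
        (by simp only [List.length_cons]; ring_nf; omega)
      convert this using 1
      funext z
      cases z <;> simp [hf]

/-- The contents of the registers as a function. -/
def regs (t p q u a c : List α) : Reg → List α
  | .todo => t
  | .past => p
  | .queue => q
  | .unseen => u
  | .aside => a
  | .cur => c

@[simp] theorem update_regs_todo :
    update (regs t p q u a c) .todo l = regs l p q u a c := by
  funext z; cases z <;> rfl

@[simp] theorem update_regs_past :
    update (regs t p q u a c) .past l = regs t l q u a c := by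
  funext z; cases z <;> rfl

@[simp] theorem update_regs_queue :
    update (regs t p q u a c) .queue l = regs t p l u a c := by
  funext z; cases z <;> rfl

@[simp] theorem update_regs_unseen :
    update (regs t p q u a c) .unseen l = regs t p q l a c := by
  funext z; cases z <;> rfl

@[simp] theorem update_regs_aside :
    update (regs t p q u a c) .aside l = regs t p q u l c := by
  funext z; cases z <;> rfl

@[simp] theorem update_regs_cur :
    update (regs t p q u a c) .cur l = regs t p q u a l := by
  funext z; cases z <;> rfl

theorem exec_expand (hN : ∀ a i, (Nat.bits (field a i)).length ≤ N) (e : α) :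
    ExecR field expand (false, ok) (regs t p (e :: q) u [] []) (false, ok)
      (regs t p ((u.filter (follows field e)).reverse ++ q)
        (u.filter fun f => !follows field e f) [] []) (u.length * (48 * (N + 1) + 4) +
          32 * (N + 1) + 2) := by
  have h1 : ExecR field (moveRec .queue .cur) (false, ok) (regs t p (e :: q) u [] []) (false, ok)
      (regs t p q u [] [e]) (16 * (N + 1)) := by
    simpa [regs] using exec_moveRec (field := field) (rs := regs t p (e :: q) u [] [])
      (x := .queue) (y := .cur) hN rfl (by decide)
  have h2 : ExecR field distribute (false, ok) (regs t p q u [] [e]) (false, ok)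
      (regs t p ((u.filter (follows field e)).reverse ++ q) []
        (u.filter fun f => !follows field e f).reverse [e]) (u.length * (32 * (N + 1) + 3) + 1) := by
    simpa [regs] using exec_distribute hN e [] _ (regs t p q u [] [e]) rfl rfl
  have h3 : ExecR field (spill .aside .unseen) (false, ok)
      (regs t p ((u.filter (follows field e)).reverse ++ q) []
        (u.filter fun f => !follows field e f).reverse [e]) (false, ok)
      (regs t p ((u.filter (follows field e)).reverse ++ q)
        (u.filter fun f => !follows field e f) [] [e])
      ((u.filter fun f => !follows field e f).length * (16 * (N + 1) + 1) + 1) := by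
    simpa [regs] using exec_spill hN (show Reg.aside ≠ .unseen by decide) _
      (regs t p ((u.filter (follows field e)).reverse ++ q) []
        (u.filter fun f => !follows field e f).reverse [e]) rfl
  have h4 : ExecR field (dropRec .cur) (false, ok) (regs t p
        ((u.filter (follows field e)).reverse ++ q)
        (u.filter fun f => !follows field e f) [] [e]) (false, ok) (regs t p
        ((u.filter (follows field e)).reverse ++ q)
        (u.filter fun f => !follows field e f) [] []) (16 * (N + 1)) := by
    simpa using exec_dropRec (x := .cur) (a := e) (l := [])
      (rs := regs t p ((u.filter (follows field e)).reverse ++ q)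
        (u.filter fun f => !follows field e f) [] [e]) hN rfl
  refine (h1.seq (h2.seq (h3.seq h4))).mono ?_
  have : (u.filter fun f => !follows field e f).length * (16 * (N + 1) + 1) ≤
      u.length * (16 * (N + 1) + 1) := by
    gcongr
    exact List.length_filter_le ..
  nlinarith

/-- Reachability in the relation `follows`. -/
def Reachable (field : α → Fin 3 → ℕ) : α → α → Prop :=
  Relation.ReflTransGen fun e f => follows field e f = true

/-- Each expansion lowers `q.length + u.length` by one, as the expanded record is dropped and its
successors merely change register; `m` bounds the cost of a round uniformly. The invariant is that a
predecessor of an unseen record is queued or unseen, i.e. not yet expanded. Once the queue is empty,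
the unseen records are therefore closed under predecessors. -/
theorem exec_search (hN : ∀ a i, (Nat.bits (field a i)).length ≤ N) {m : ℕ} :
    ∀ (n : ℕ) (q u : List α), q.length + u.length = n → u.length ≤ m →
      (∀ e f, follows field e f = true → f ∈ u → e ∈ q ∨ e ∈ u) →
      ∃ u', ExecR field search (false, ok) (regs t p q u [] []) (false, ok) (regs t p [] u' [] [])
          (n * (100 * (N + 1) * (m + 1)) + 1) ∧
        u'.length ≤ u.length ∧ (∀ f ∈ u', f ∈ u) ∧
        (∀ f ∈ u, f ∈ u' ∨ ∃ e ∈ q, Reachable field e f) ∧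
        ∀ e f, follows field e f = true → f ∈ u' → e ∈ u' := by
  intro n
  induction n with
  | zero =>
    intro q u hn hm h
    obtain ⟨rfl, rfl⟩ : q = [] ∧ u = [] := by
      simpa using hn
    exact ⟨[], (ExecR.while_nil rfl).mono (by omega), by simp⟩
  | succ n ih =>
    intro q u hn hm h
    cases q with
    | nil =>
      exact ⟨u, (ExecR.while_nil rfl).mono (by omega), le_rfl, fun _ h => h, fun _ h => .inl h,
        fun e f hef hf => (h e f hef hf).resolve_left (by simp)⟩
    | cons e q =>
      have hlen : (u.filter (follows field e)).length +
          (u.filter fun f => !follows field e f).length = u.length := by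
        rw [← List.countP_eq_length_filter, ← List.countP_eq_length_filter]
        simpa using (List.length_eq_countP_add_countP (follows field e) (l := u)).symm
      obtain ⟨u', hx, h1, h2, h3, h4⟩ := ih ((u.filter (follows field e)).reverse ++ q)
        (u.filter fun f => !follows field e f)
        (by simp only [List.length_cons] at hn; simp only [List.length_append, List.length_reverse]
            omega) (by omega) (by
          intro a f haf hf
          rw [List.mem_filter] at hf
          -- The invariant survives: `f` stayed unseen, so its predecessor `a` is not the expanded
          -- `e`; if `a` was unseen, it is now queued or still unseen.
          rcases h a f haf hf.1 with ha | ha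
          · rcases List.mem_cons.1 ha with rfl | ha
            · simp [haf] at hf
            · simp [ha]
          · cases hea : follows field e a <;> simp [ha, hea])
      refine ⟨u', (ExecR.while_cons rfl (exec_expand hN e) hx).mono ?_, by omega,
        fun f hf => List.mem_of_mem_filter (h2 f hf), ?_, h4⟩
      · have : u.length * (48 * (N + 1) + 4) ≤ m * (48 * (N + 1) + 4) := by gcongr
        nlinarith [Nat.zero_le (m * N)]
      · intro f hf
        by_cases hef : follows field e f = true
        · exact .inr ⟨e, by simp, .single hef⟩
        · rcases h3 f (by simp [hf, hef]) with h | ⟨a, ha, haf⟩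
          · exact .inl h
          · rw [List.mem_append, List.mem_reverse, List.mem_filter] at ha
            rcases ha with ha | ha
            · exact .inr ⟨e, by simp, .head ha.2 haf⟩
            · exact .inr ⟨a, by simp [ha], haf⟩

theorem exec_clearUnseen (hN : ∀ a i, (Nat.bits (field a i)).length ≤ N) :
    ∀ (u : List α) (ok : Bool),
      ExecR field clearUnseen (false, ok) (regs t p q u a c) (false, ok && u.isEmpty)
        (regs t p q [] a c) (u.length * (16 * (N + 1) + 2) + 1) := by
  intro u
  induction u with
  | nil =>
    intro ok
    rw [clearUnseen]
    simpa using ExecR.while_nil (v := (false, ok)) (rs := regs t p q [] a c) (x := .unseen) rfl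
  | cons e u ih =>
    intro ok
    have h1 := exec_dropRec (v := (false, ok)) (rs := regs t p q (e :: u) a c) (x := .unseen) hN rfl
    rw [update_regs_unseen] at h1
    have h2 := ExecR.while_cons rfl (h1.seq (exec_load fun v : Flags => (v.1, false))) (ih false)
    replace h2 := h2.mono (u := (e :: u).length * (16 * (N + 1) + 2) + 1)
      (by simp only [List.length_cons]; ring_nf; omega)
    rw [clearUnseen]
    simpa using h2

end StackMachine

/-! ### One search for each arc, and the whole program -/

namespace StackMachine

open Function

variable {α : Type} {field : α → Fin 3 → ℕ} {rs : Reg → List α} {N : ℕ} {ok : Bool}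
  {t p q u a c l : List α}

/-- All trails required from the record `e` exist. -/
def Good (field : α → Fin 3 → ℕ) (pc : Bool) (e : α) : Prop :=
  (∀ f, closesWell field pc e f = true) ∧ ∀ f, Reachable field e f

/-- While `e` is parked in `cur`, the two scans test all other records and refill `unseen` with
exactly these. The search from `e` then leaves `unseen` empty iff everything is reachable from `e`.
-/
theorem exec_visit (hN : ∀ a i, (Nat.bits (field a i)).length ≤ N)
    (hne : ∀ e, field e 1 ≠ field e 0) (pc : Bool) {e : α} (hmem : ∀ f, f ∈ e :: t ++ p)
    (hnd : (e :: t ++ p).Nodup) :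
    ∃ ok', ExecR field (visit pc) (false, ok) (regs (e :: t) p [] [] [] []) (false, ok')
        (regs t (e :: p) [] [] [] []) (300 * (N + 1) * (t.length + p.length + 1) ^ 2) ∧
      (ok' = true ↔ ok = true ∧ Good field pc e) := by
  have hu : ∀ f, f = e ∨ f ∈ p.reverse ++ t.reverse := fun f => by
    have := hmem f
    simp only [List.cons_append, List.mem_cons, List.mem_append, List.mem_reverse] at this ⊢
    tauto
  have heu : e ∉ p.reverse ++ t.reverse := by
    have : e ∉ t ++ p := (List.nodup_cons.1 hnd).1
    simp only [List.mem_append, List.mem_reverse] at this ⊢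
    tauto
  have h1 : ExecR field (copyRec .todo .queue) (false, ok) (regs (e :: t) p [] [] [] []) (false, ok)
      (regs (e :: t) p [e] [] [] []) (16 * (N + 1)) := by
    simpa [regs] using exec_copyRec (field := field) (rs := regs (e :: t) p [] [] [] [])
      (x := .todo) (y := .queue) hN rfl (by decide)
  have h2 : ExecR field (moveRec .todo .cur) (false, ok) (regs (e :: t) p [e] [] [] []) (false, ok)
      (regs t p [e] [] [] [e]) (16 * (N + 1)) := by
    simpa [regs] using exec_moveRec (field := field) (rs := regs (e :: t) p [e] [] [] [])
      (x := .todo) (y := .cur) hN rfl (by decide)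
  have h3 : ExecR field (scan pc .todo) (false, ok) (regs t p [e] [] [] [e])
      (false, ok && t.all (closesWell field pc e)) (regs t p [e] t.reverse [] [e])
      (t.length * (64 * (N + 1) + 2) + 2) := by
    simpa [regs] using exec_scan (rs := regs t p [e] [] [] [e]) (ok := ok) (x := .todo) hN pc
      (by decide) (by decide) (by decide) rfl rfl
  have h4 : ExecR field (scan pc .past) (false, ok && t.all (closesWell field pc e))
      (regs t p [e] t.reverse [] [e])
      (false, ok && t.all (closesWell field pc e) && p.all (closesWell field pc e))
      (regs t p [e] (p.reverse ++ t.reverse) [] [e]) (p.length * (64 * (N + 1) + 2) + 2) := by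
    simpa [regs] using exec_scan (rs := regs t p [e] t.reverse [] [e])
      (ok := ok && t.all (closesWell field pc e)) (x := .past) hN pc
      (by decide) (by decide) (by decide) rfl rfl
  have h5 (ok : Bool) : ExecR field (moveRec .cur .past) (false, ok)
      (regs t p [e] (p.reverse ++ t.reverse) [] [e])
      (false, ok) (regs t (e :: p) [e] (p.reverse ++ t.reverse) [] []) (16 * (N + 1)) := by
    simpa [regs] using exec_moveRec (field := field)
      (rs := regs t p [e] (p.reverse ++ t.reverse) [] [e])
      (x := .cur) (y := .past) hN rfl (by decide)
  obtain ⟨u', h6, hlen, hsub, hreach, hback⟩ := exec_search (t := t) (p := e :: p)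
    (ok := ok && t.all (closesWell field pc e) && p.all (closesWell field pc e)) hN
    _ [e] (p.reverse ++ t.reverse) rfl le_rfl
    -- Initially every record is `e` or unseen, so the search invariant holds trivially.
    (fun f g _ _ => by simpa using hu f)
  have h7 := exec_clearUnseen (t := t) (p := e :: p) (q := []) (a := []) (c := []) hN u'
    (ok && t.all (closesWell field pc e) && p.all (closesWell field pc e))
  refine ⟨_, (h1.seq (h2.seq (h3.seq (h4.seq ((h5 _).seq (h6.seq h7)))))).mono ?_, ?_⟩
  · have : u'.length * (16 * (N + 1) + 2) ≤ (t.length + p.length) * (16 * (N + 1) + 2) := by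
      gcongr
      simpa [add_comm] using hlen
    simp only [List.length_append, List.length_reverse, List.length_singleton]
    generalize t.length = x at *
    generalize p.length = y at *
    -- The search dominates: at most `x + y + 1` expansions, each within `100 * (N + 1) * (x + y +
    -- 1)` steps.
    have : (1 + (y + x)) * (100 * (N + 1) * (y + x + 1)) = 100 * (N + 1) * (x + y + 1) ^ 2 := by
      ring
    rw [this]
    have : (N + 1) * (x + y + 1) ≤ (N + 1) * (x + y + 1) ^ 2 := by
      gcongr
      exact Nat.le_self_pow (by norm_num) _
    nlinarith [Nat.zero_le (N * x), Nat.zero_le (N * y)]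
  · have hall : (t.all (closesWell field pc e) = true ∧ p.all (closesWell field pc e) = true) ↔
        ∀ f, closesWell field pc e f = true := by
      simp only [List.all_eq_true]
      refine ⟨fun h f => ?_, fun h => ⟨fun f _ => h f, fun f _ => h f⟩⟩
      rcases hu f with rfl | hf
      -- The scans skip `e` itself, which is harmless: its head differs from its tail, so the
      -- one-arc trail is not closed.
      · simp [closesWell, hne]
      · rcases List.mem_append.1 hf with hf | hf
        · exact h.2 f (List.mem_reverse.1 hf)
        · exact h.1 f (List.mem_reverse.1 hf)
    have hemp : u' = [] ↔ ∀ f, Reachable field e f := by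
      constructor
      · rintro rfl f
        rcases hu f with rfl | hf
        · exact .refl
        · simpa using hreach f hf
      · intro h
        rw [List.eq_nil_iff_forall_not_mem]
        intro f hf
        -- Closure under predecessors pulls membership in `u'` back along a path to `e`, which was
        -- never unseen.
        have : ∀ g, Reachable field e g → g ∈ u' → e ∈ u' := fun g hg => by
          induction hg with
          | refl => exact id
          | tail _ hab ih => exact fun hb => ih (hback _ _ hab hb)
        exact heu (hsub e (this f (h f) hf))
    simp only [Bool.and_eq_true, List.isEmpty_iff, hemp, Good, ← hall]
    tauto

/-- Visited records pass from `todo` to `past`, so `t ++ p` stays a duplicate-free enumeration of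
all records, as each search requires. -/
theorem exec_visit_loop (hN : ∀ a i, (Nat.bits (field a i)).length ≤ N)
    (hne : ∀ e, field e 1 ≠ field e 0) (pc : Bool) {m : ℕ} :
    ∀ (t p : List α) (ok : Bool), (∀ f, f ∈ t ++ p) → (t ++ p).Nodup → t.length + p.length = m →
    ∃ ok' p', ExecR field (whileReg .todo (visit pc)) (false, ok) (regs t p [] [] [] []) (false, ok')
        (regs [] p' [] [] [] []) (t.length * (300 * (N + 1) * (m + 1) ^ 2 + 1) + 1) ∧
      p'.length = m ∧ (ok' = true ↔ ok = true ∧ ∀ e ∈ t, Good field pc e) := by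
  intro t
  induction t with
  | nil =>
    intro p ok _ _ hm
    exact ⟨ok, p, (ExecR.while_nil rfl).mono (by simp), by simpa using hm, by simp⟩
  | cons e t ih =>
    intro p ok hmem hnd hm
    obtain ⟨ok₁, h1, h1'⟩ := exec_visit (ok := ok) hN hne pc hmem hnd
    obtain ⟨ok', p', h2, h3, h4⟩ := ih (e :: p) ok₁
      (fun f => (List.perm_middle.mem_iff).2 (hmem f)) (List.perm_middle.nodup_iff.2 hnd)
      (by simp only [List.length_cons] at hm ⊢; omega)
    refine ⟨ok', p', (ExecR.while_cons rfl h1 h2).mono ?_, h3, ?_⟩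
    · have : 300 * (N + 1) * (t.length + p.length + 1) ^ 2 ≤ 300 * (N + 1) * (m + 1) ^ 2 := by
        gcongr
        simp only [List.length_cons] at hm
        omega
      simp only [List.length_cons]
      nlinarith
    · rw [h4, h1']
      simp only [List.mem_cons, forall_eq_or_imp]
      tauto

theorem exec_dropAll (hN : ∀ a i, (Nat.bits (field a i)).length ≤ N) {v : Flags} :
    ∀ p : List α, ExecR field (whileReg .past (dropRec .past)) v (regs t p q u a c) v
      (regs t [] q u a c) (p.length * (16 * (N + 1) + 1) + 1) := by
  intro p
  induction p with
  | nil => simpa using ExecR.while_nil (rs := regs t [] q u a c) (x := .past) rfl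
  | cons e p ih =>
    have h := exec_dropRec (v := v) (rs := regs t (e :: p) q u a c) (x := .past) hN rfl
    rw [update_regs_past] at h
    exact (ExecR.while_cons rfl h ih).mono (by simp only [List.length_cons]; ring_nf; omega)

/-- The numbers of a list of records. -/
def numbers (field : α → Fin 3 → ℕ) (l : List α) : List ℕ :=
  l.flatMap fun f => [field f 0, field f 1, field f 2]

theorem exec_read (hN : ∀ a i, (Nat.bits (field a i)).length ≤ N) {v : Flags} :
    ∀ l t : List α, Exec (.whileNE (.inl none) (readRec .todo)) v
      (columns field (numbers field l) (regs t p q u a c)) v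
      (columns field [] (regs (l.reverse ++ t) p q u a c)) (l.length * (16 * (N + 1) + 1) + 1) := by
  intro l
  induction l with
  | nil =>
    intro t
    simpa [numbers] using Exec.whileNE_nil (ws := columns field [] (regs t p q u a c)) (c := none) rfl
  | cons e l ih =>
    intro t
    have h := exec_readRec (v := v) (a := e) (inp := numbers field l) (rs := regs t p q u a c)
      (x := .todo) hN
    rw [update_regs_todo] at h
    have h' := (Exec.whileNE_cons (by simp [columns]) h (ih _)).mono
      (u := (e :: l).length * (16 * (N + 1) + 1) + 1)
      (by simp only [List.length_cons]; ring_nf; omega)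
    simpa [numbers, regs] using h'

/-- The numbers of vertices and colors are discarded, since the arcs alone determine the answer. The
fourth power comes from at most `N` visits, each cubic in `N + 1`. -/
theorem exec_program (hN : ∀ a i, (Nat.bits (field a i)).length ≤ N)
    (hne : ∀ e, field e 1 ≠ field e 0) (pc : Bool) {l : List α} (hl : ∀ f, f ∈ l) (hnd : l.Nodup)
    (hlN : l.length ≤ N) {n k : ℕ} (hn : (Nat.bits n).length ≤ N) (hk : (Nat.bits k).length ≤ N) :
    ∃ ok, Exec (program pc) (false, true)
        (columns field (n :: k :: numbers field l) (regs [] [] [] [] [] [])) (false, ok)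
        (columns field [] (regs [] [] [] [] [] [])) (500 * (N + 1) ^ 4) ∧
      (ok = true ↔ ∀ e, Good field pc e) := by
  have h1 := exec_dropNum (v := ((false, true) : Flags)) (c := (none : Col))
    (ws := columns field (n :: k :: numbers field l) (regs [] [] [] [] [] [])) rfl hn
  have h2 := exec_dropNum (v := ((false, true) : Flags)) (c := (none : Col))
    (ws := columns field (k :: numbers field l) (regs [] [] [] [] [] [])) rfl hk
  have e1 (l l' : List ℕ) (rs : Reg → List α) :
      update (columns field l rs) none l' = columns field l' rs := by
    funext z; cases z <;> rfl
  rw [e1] at h1 h2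
  have h3 := exec_read (v := ((false, true) : Flags)) (p := []) (q := []) (u := []) (a := [])
    (c := []) hN l []
  rw [List.append_nil] at h3
  obtain ⟨ok, p', h4, h5, h6⟩ := exec_visit_loop hN hne pc l.reverse [] true
    (by simpa using hl) (by simpa using hnd) rfl
  have h7 := exec_dropAll (v := (false, ok)) (t := []) (q := []) (u := []) (a := []) (c := []) hN p'
  refine ⟨ok, (h1.seq (h2.seq (h3.seq (Exec.seq h4 h7)))).mono ?_, ?_⟩
  · rw [h5]
    simp only [List.length_reverse, List.length_nil, add_zero]
    calc _ ≤ N + 1 + (N + 1 + (N * (16 * (N + 1) + 1) + 1 +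
          (N * (300 * (N + 1) * (N + 1) ^ 2 + 1) + 1 + (N * (16 * (N + 1) + 1) + 1)))) := by gcongr
      _ ≤ _ := by ring_nf; omega
  · simp [h6, hl]

end StackMachine

/-! ### From fragments to Turing machines -/

namespace StackMachine

open Function Turing

section Machine

variable {S V : Type} [DecidableEq S] [Fintype S] [Fintype V]

/-- The machine that executes the fragment `p` with the input on the stack `k`, starting with the
flags `v`, and then outputs a bit computed from the flags. -/
def machine (p : Frag S V) (k : S) (v : V) (out : V → Bool) : FinTM2 :=
  have := p.fin
  { K := Option S
    k₀ := some k
    k₁ := none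
    Γ := Alph S
    Λ := Option p.Λ
    main := some p.start
    σ := Store V
    initialState := rest v
    Γk₀Fin := inferInstanceAs (Fintype (Option Bool))
    m := fun
      | some l => p.code _ some none l
      | none => .push none (fun s => out s.v) (.load (fun _ => rest v) .halt) }

/-- A halting configuration in the sense of `haltList` has the initial store and only the output
stack filled. Hence the fragment must empty all its stacks, and the additional last step resets the
store while writing the answer. -/
theorem machine_outputs {p : Frag S V} {k : S} {v v' : V} (out : V → Bool) {w : List Sym} {t : ℕ}
    (h : Runs p (rest v) (update (fun _ => []) k w) (rest v') (fun _ => []) t) :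
    Nonempty (TM2OutputsInTime (machine p k v out) w (some [out v']) (t + 1)) := by
  obtain ⟨n, hn, e⟩ := (h _ some none (machine p k v out).m fun _ => rfl).trans
    (Steps.single (b := ⟨none, rest v, update (extend fun _ => []) none [out v']⟩) rfl)
  have hi : initList (machine p k v out) w =
      ⟨some (some p.start), rest v, extend (update (fun _ => []) k w)⟩ := by
    unfold initList
    congr 1
    funext j
    rcases j with _ | j
    · rfl
    · by_cases hj : j = k
      · subst hj
        exact (dif_pos rfl).trans (update_self (f := fun _ : S => ([] : List Sym)) ..).symm
      · refine (dif_neg fun e => hj (Option.some.inj e)).trans ?_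
        change [] = update (fun _ => []) k w j
        rw [update_of_ne hj]
  have ho : haltList (machine p k v out) [out v'] =
      ⟨none, rest v, update (extend fun _ => []) none [out v']⟩ := by
    unfold haltList
    congr 1
    funext j
    rcases j with _ | j <;> rfl
  exact ⟨⟨⟨n, by rw [hi, Option.map_some, ho]; exact e⟩, hn⟩⟩

theorem decidableInPolyTime_of_runs {α : Type} {enc : α → List Sym} {P : α → Prop} (p : Frag S V)
    (k : S) (v : V) (out : V → Bool) (T : Polynomial ℕ)
    (h : ∀ a, ∃ v', Runs p (rest v) (update (fun _ => []) k (enc a)) (rest v') (fun _ => [])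
      (T.eval (enc a).length) ∧ (out v' = true ↔ P a)) :
    DecidableInPolyTime enc P := by
  choose v' hr hP using h
  exact ⟨fun a => out (v' a), hP, ⟨{
    tm := machine p k v out
    inputAlphabet := Equiv.refl _
    outputAlphabet := Equiv.refl _
    time := T + 1
    outputsFun := fun a => Classical.choice (by
      have := machine_outputs out (hr a)
      rw [Polynomial.eval_add, Polynomial.eval_one]
      exact cast (congrArg (fun w : List Sym => Nonempty (TM2OutputsInTime (machine p k v out) w
        (some [out (v' a)]) (T.eval (enc a).length + 1))) (List.map_id (enc a)).symm) this) }⟩⟩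

end Machine

end StackMachine

/-! ### Trails as reachability between arcs -/

namespace ArcColoredDigraph

variable {V : Type} {c : ℕ} {G : ArcColoredDigraph V c}

/-- The arc `f` can directly follow the arc `e` on a properly colored trail. -/
def Follows (G : ArcColoredDigraph V c) (e f : G.Arc) : Prop :=
  G.head e = G.tail f ∧ G.color e ≠ G.color f

theorem isPCFEVTrail_iff {T : List G.Arc} :
    G.IsPCFEVTrail T ↔ T ≠ [] ∧ T.IsChain G.Follows ∧ T.Nodup := by
  have : T.IsChain G.Follows ↔
      T.IsChain (fun e f => G.head e = G.tail f) ∧ T.IsChain fun e f => G.color e ≠ G.color f := by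
    simp only [List.isChain_iff_getElem, Follows, ← forall_and]
  rw [IsPCFEVTrail, IsTrail, this]
  tauto

/-- A trail is in particular a walk in `G.Follows`. Conversely, a trail is built backwards from `f`,
one arc at a time, with repetitions removed as they arise. -/
theorem exists_isPCFEVTrail_iff {e f : G.Arc} :
    (∃ T, G.IsPCFEVTrail T ∧ G.StartsWith T e ∧ G.EndsWith T f) ↔
      Relation.ReflTransGen G.Follows e f := by
  simp only [isPCFEVTrail_iff, StartsWith, EndsWith]
  constructor
  · rintro ⟨T, ⟨-, hT, -⟩, he, hf⟩
    induction T generalizing e with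
    | nil => simp at he
    | cons a T ih =>
      obtain rfl : a = e := by simpa using he
      cases T with
      | nil =>
        obtain rfl : a = f := by simpa using hf
        exact .refl
      | cons b T =>
        rw [List.isChain_cons_cons] at hT
        exact .head hT.1 (ih hT.2 rfl (by simpa using hf))
  · intro h
    induction h using Relation.ReflTransGen.head_induction_on with
    | refl => exact ⟨[f], by simp⟩
    | @head a b hab _ ih =>
      obtain ⟨T, ⟨hne, hT, hnd⟩, hb, hf⟩ := ih
      by_cases ha : a ∈ T
      -- If `a` already lies on the trail, the part from `a` onwards is the trail wanted.
      · obtain ⟨A, B, rfl⟩ := List.append_of_mem ha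
        exact ⟨a :: B, ⟨by simp, hT.right_of_append, hnd.of_append_right⟩, rfl, by simpa using hf⟩
      · cases T with
        | nil => simp at hb
        | cons b' T =>
          obtain rfl : b' = b := by simpa using hb
          exact ⟨a :: b' :: T, ⟨by simp, hT.cons_cons hab, List.nodup_cons.2 ⟨ha, hnd⟩⟩, rfl,
            by simpa using hf⟩

theorem pcFEVTrailConnected_iff :
    G.PCFEVTrailConnected ↔ ∀ e f : G.Arc, Relation.ReflTransGen G.Follows e f :=
  forall₂_congr fun _ _ => exists_isPCFEVTrail_iff

/-- The closing condition mentions only the two end arcs, which are prescribed, so it separates from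
the existence of a trail. -/
theorem pcTrailConnected_iff :
    G.PCTrailConnected ↔ ∀ e f : G.Arc, (G.head f = G.tail e → G.color e ≠ G.color f) ∧
      Relation.ReflTransGen G.Follows e f := by
  refine forall₂_congr fun e f => ?_
  rw [← exists_isPCFEVTrail_iff]
  constructor
  · rintro ⟨T, ⟨h1, h2, h3⟩, he, hf⟩
    exact ⟨h3 e f he hf, T, ⟨h1, h2⟩, he, hf⟩
  · rintro ⟨h, T, ⟨h1, h2⟩, he, hf⟩
    refine ⟨T, ⟨h1, h2, fun e' f' he' hf' => ?_⟩, he, hf⟩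
    obtain rfl : e = e' := Option.some.inj (he.symm.trans he')
    obtain rfl : f = f' := Option.some.inj (hf.symm.trans hf')
    exact h

end ArcColoredDigraph

/-! ### Transfer to encoded digraphs -/

namespace DigraphInput

open StackMachine

/-- The three numbers by which an arc is described in the input. -/
def field (I : DigraphInput) (f : I.G.Arc) : Fin 3 → ℕ :=
  ![I.G.tail f, I.G.head f, I.G.color f]

theorem encode_eq (I : DigraphInput) :
    I.encode = (I.n :: I.c :: numbers I.field I.arcList).flatMap encodeNumber := by
  simp [encode, numbers, field, List.flatMap_assoc]

theorem length_encodeNumber (k : ℕ) : (encodeNumber k).length = (Nat.bits k).length + 1 := by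
  simp [encodeNumber]

theorem length_bits_le (I : DigraphInput) {k : ℕ}
    (hk : k ∈ I.n :: I.c :: numbers I.field I.arcList) :
    (Nat.bits k).length ≤ I.encode.length := by
  have h : (encodeNumber k).length ≤ I.encode.length := by
    rw [encode_eq, List.length_flatMap]
    exact List.single_le_sum (by simp) _ (List.mem_map_of_mem hk)
  rw [length_encodeNumber] at h
  omega

/-- Every number contributes at least its separator to the input. -/
theorem length_arcList_le (I : DigraphInput) : I.arcList.length ≤ I.encode.length := by
  have h (l : List I.G.Arc) : l.length ≤ ((numbers I.field l).flatMap encodeNumber).length := by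
    induction l with
    | nil => simp
    | cons a l ih =>
      have e : numbers I.field (a :: l) =
        [I.field a 0, I.field a 1, I.field a 2] ++ numbers I.field l := rfl
      rw [e, List.flatMap_append, List.length_append]
      simp only [List.flatMap_cons, List.length_append, length_encodeNumber, List.length_cons]
      omega
  rw [encode_eq, List.flatMap_cons, List.flatMap_cons, List.length_append, List.length_append]
  have := h I.arcList
  omega

theorem follows_iff (I : DigraphInput) (e f : I.G.Arc) :
    follows I.field e f = true ↔ I.G.Follows e f := by
  simp only [follows, Bool.and_eq_true, Bool.not_eq_true', decide_eq_true_eq,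
    decide_eq_false_iff_not]
  simp [field, ArcColoredDigraph.Follows, Fin.ext_iff]

theorem closesWell_iff (I : DigraphInput) (pc : Bool) (e f : I.G.Arc) :
    closesWell I.field pc e f = true ↔
      (pc = true → I.G.head f = I.G.tail e → I.G.color e ≠ I.G.color f) := by
  simp only [closesWell, Bool.not_eq_true', Bool.and_eq_false_iff, decide_eq_false_iff_not,
    ne_eq, Fin.ext_iff, eq_comm (a := (I.G.color e : ℕ))]
  cases pc <;> simp [field, imp_iff_not_or]

theorem forall_good_iff (I : DigraphInput) (pc : Bool) :
    (∀ e, Good I.field pc e) ↔ ∀ e f : I.G.Arc,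
      (pc = true → I.G.head f = I.G.tail e → I.G.color e ≠ I.G.color f) ∧
        Relation.ReflTransGen I.G.Follows e f := by
  simp only [Good, Reachable, closesWell_iff, follows_iff, ← forall_and]

theorem decidableInPolyTime_good (pc : Bool) :
    DecidableInPolyTime encode fun I => ∀ e, Good I.field pc e := by
  refine decidableInPolyTime_of_runs (program pc) (.inl none) (false, true) Prod.snd
    (500 * (Polynomial.X + 1) ^ 4) fun I => ?_
  -- The input length bounds both the number of arcs and the length of each number, so it can serve
  -- as `N`.
  obtain ⟨ok, h, hok⟩ := exec_program (N := I.encode.length) (field := I.field) (n := I.n)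
    (k := I.c) (fun f i => I.length_bits_le (by
      simp only [numbers, List.mem_cons, List.mem_flatMap]
      exact .inr (.inr ⟨f, I.complete f, by fin_cases i <;> simp⟩)))
    -- Looplessness supplies the requirement that the head and tail numbers of a record differ.
    (fun e h => I.G.loopless e.1.1 (by
      have : I.G.head e = I.G.tail e := Fin.ext h
      convert e.2 using 1
      exact Prod.ext rfl this.symm)) pc I.complete I.nodup I.length_arcList_le
    (I.length_bits_le (by simp)) (I.length_bits_le (by simp))
  refine ⟨(false, ok), ?_, hok⟩
  have e1 : lay (columns I.field (I.n :: I.c :: numbers I.field I.arcList)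
      (regs [] [] [] [] [] [])) = Function.update (fun _ => []) (.inl none) I.encode := by
    rw [encode_eq]
    funext z
    rcases z with (_ | ⟨x, i⟩) | z
    · simp [lay, columns]
    · cases x <;> simp [lay, columns, regs]
    · simp [lay]
  have e2 : lay (columns I.field [] (regs [] [] [] [] [] [])) = fun _ => [] := by
    funext z
    rcases z with (_ | ⟨x, i⟩) | z
    · simp [lay, columns]
    · cases x <;> simp [lay, columns, regs]
    · simp [lay]
  rw [Exec, e1, e2] at h
  simpa using h

end DigraphInput

theorem mainTheorem5 :
    DecidableInPolyTime DigraphInput.encode (fun I => I.G.PCTrailConnected) ∧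
      DecidableInPolyTime DigraphInput.encode (fun I => I.G.PCFEVTrailConnected) := by
  constructor
  · convert DigraphInput.decidableInPolyTime_good true using 2 with I
    rw [ArcColoredDigraph.pcTrailConnected_iff, I.forall_good_iff]
    simp
  · convert DigraphInput.decidableInPolyTime_good false using 2 with I
    rw [ArcColoredDigraph.pcFEVTrailConnected_iff, I.forall_good_iff]
    simp
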